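/- Let $1<k<n$ be integers. Let $G(k,n)$ be the set of $k$-dimensional linear subspaces of $\mathbb{R}^n$, with its rotation-invariant probability measure. Let $A(1,n)$ be the set of affine lines in $\mathbb{R}^n$ and, for $V\in G(k,n)$, let $A(1,V)$ be the set of affine lines contained in $V$. A line $\ell$ is written uniquely as $\ell=\operatorname{dir}(\ell)+x_\ell$ with $\operatorname{dir}(\ell)$ a one-dimensional linear subspace and $x_\ell\perp\operatorname{dir}(\ell)$, and spaces of lines carry the metric $$d(\ell,\ell')=\|P_{\operatorname{dir}(\ell)}-P_{\operatorname{dir}(\ell')}\|+|x_\ell-x_{\ell'}|,$$ where $P_W$ denotes the orthogonal projection onto a subspace $W$ and $\|\cdot\|$ the operator norm. For $V\in G(k,n)$ let $$\pi_V:A(1,n)\to A(1,V)\sqcup V,\qquad \ell\mapsto P_V(\ell),$$ the image $P_V(\ell)$ being either a line in $V$ or a point of $V$. Let $\dim$ denote Hausdorff dimension; in the disjoint union $A(1,V)\sqcup V$ the two parts keep their own metrics and are at positive distance from each other. For $0\le a\le 2(n-1)$ define $$S(a)=\inf_{\substack{\mathbf{A}\subset A(1,n)\text{ Borel}\\ \dim(\mathbf{A})=a}}\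 \operatorname*{ess\,sup}_{V\in G(k,n)}\ \dim(\pi_V(\mathbf{A})).$$ Then $$S(a)\le\min\{a,\,k-1\}\quad\text{for } a\in[0,n-1],$$ $$S(a)\le\min\{a-(n-k),\,2(k-1)\}\quad\text{for } a\in[n-1,2(n-1)].$$ -/

import Mathlib

open MeasureTheory Module
open scoped ENNReal

noncomputable section

namespace LineProjection

/-- The Grassmannian `G(k, E)` of `k`-dimensional linear subspaces of `E`. -/
@[ext]
structure Grass (k : ℕ) (E : Type*) [NormedAddCommGroup E] [InnerProductSpace ℝ E] where
  /-- the underlying linear subspace -/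
  space : Submodule ℝ E
  finrank_space : finrank ℝ space = k

/-- The affine Grassmannian `A(l, E)` of `l`-dimensional affine subspaces of `E`. -/
@[ext]
structure AffGrass (l : ℕ) (E : Type*) [NormedAddCommGroup E] [InnerProductSpace ℝ E] where
  /-- the underlying affine subspace -/
  plane : AffineSubspace ℝ E
  nonempty : (plane : Set E).Nonempty
  finrank_direction : finrank ℝ plane.direction = l

section Metrics

variable {k l : ℕ} {E : Type*} [NormedAddCommGroup E] [InnerProductSpace ℝ E]
  [FiniteDimensional ℝ E]

/-- The metric `d(V, W) = ‖P_V - P_W‖` (operator norm) on `G(k, E)`. -/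
instance : MetricSpace (Grass k E) where
  dist V W := ‖V.space.starProjection - W.space.starProjection‖
  dist_self V := by simp
  dist_comm V W := norm_sub_rev _ _
  dist_triangle U V W := norm_sub_le_norm_sub_add_norm_sub _ _ _
  eq_of_dist_eq_zero {V W} h :=
    Grass.ext (Submodule.starProjection_inj.mp (sub_eq_zero.mp (norm_eq_zero.mp h)))

/-- `G(k, E)` carries its Borel σ-algebra. -/
instance : MeasurableSpace (Grass k E) := borel _

instance : BorelSpace (Grass k E) := ⟨rfl⟩

/-- The foot `x_L` of an affine subspace `L = dir L + x_L`, `x_L ⊥ dir L`: the orthogonal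
projection of the origin to `L`. -/
def AffGrass.foot (L : AffGrass l E) : E :=
  haveI : Nonempty L.plane := L.nonempty.to_subtype
  (EuclideanGeometry.orthogonalProjection L.plane (0 : E) : E)

theorem AffGrass.foot_mem (L : AffGrass l E) : L.foot ∈ L.plane := by
  have : Nonempty L.plane := L.nonempty.to_subtype
  exact EuclideanGeometry.orthogonalProjection_mem (0 : E)

/-- The metric `d(L, M) = ‖P_{dir L} - P_{dir M}‖ + ‖x_L - x_M‖` on `A(l, E)`. -/
instance : MetricSpace (AffGrass l E) where
  dist L M := ‖L.plane.direction.starProjection - M.plane.direction.starProjection‖ +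
    ‖L.foot - M.foot‖
  dist_self L := by simp
  dist_comm L M := by
    rw [norm_sub_rev L.plane.direction.starProjection, norm_sub_rev L.foot]
  dist_triangle L M N := by
    have h₁ := norm_sub_le_norm_sub_add_norm_sub L.plane.direction.starProjection
      M.plane.direction.starProjection N.plane.direction.starProjection
    have h₂ := norm_sub_le_norm_sub_add_norm_sub L.foot M.foot N.foot
    linarith
  eq_of_dist_eq_zero {L M} h := by
    have h₁ : ‖L.plane.direction.starProjection - M.plane.direction.starProjection‖ = 0 := by
      linarith [norm_nonneg (L.plane.direction.starProjection - M.plane.direction.starProjection),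
        norm_nonneg (L.foot - M.foot)]
    have h₂ : ‖L.foot - M.foot‖ = 0 := by linarith
    have h₃ : L.foot = M.foot := sub_eq_zero.mp (norm_eq_zero.mp h₂)
    refine AffGrass.ext (AffineSubspace.ext_of_direction_eq
      (Submodule.starProjection_inj.mp (sub_eq_zero.mp (norm_eq_zero.mp h₁)))
      ⟨L.foot, L.foot_mem, ?_⟩)
    rw [h₃]
    exact M.foot_mem

/-- `A(l, E)` carries its Borel σ-algebra. -/
instance : MeasurableSpace (AffGrass l E) := borel _

instance : BorelSpace (AffGrass l E) := ⟨rfl⟩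

attribute [local instance] Metric.metricSpaceSum in
/-- The Hausdorff dimension of a subset of the disjoint union `A(1, V) ⊔ V`, metrized so that the
two parts keep their own metric and lie at distance at least one from each other. -/
def dimTarget (V : Submodule ℝ E) (s : Set (AffGrass 1 V ⊕ V)) : ℝ≥0∞ := dimH s

/-- The image `P_V(L)` of a line `L` under the orthogonal projection to `V`, as an affine subspace
of `V`. -/
def imageIn (V : Submodule ℝ E) (L : AffGrass 1 E) : AffineSubspace ℝ V :=
  L.plane.map V.orthogonalProjectionOnto.toLinearMap.toAffineMap

open Classical in
/-- The map `π_V : A(1, E) → A(1, V) ⊔ V`, `L ↦ P_V(L)`. If the image of `L` is not a line, then it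
is the single point `P_V(x_L)`. -/
def proj (V : Submodule ℝ E) (L : AffGrass 1 E) : AffGrass 1 V ⊕ V :=
  if h : finrank ℝ (imageIn V L).direction = 1 then
    Sum.inl ⟨imageIn V L, ⟨V.orthogonalProjectionOnto L.foot, L.foot, L.foot_mem, rfl⟩, h⟩
  else Sum.inr (V.orthogonalProjectionOnto L.foot)

end Metrics

/-- Euclidean space `ℝⁿ`. -/
abbrev Euc (n : ℕ) : Type := EuclideanSpace ℝ (Fin n)

/-- The orthogonal group of `ℝⁿ`, with the topology of the operator norm. -/
abbrev Orth (n : ℕ) : Type := unitary (Euc n →L[ℝ] Euc n)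

instance (n : ℕ) : ContinuousStar (Euc n →L[ℝ] Euc n) :=
  ⟨(ContinuousLinearMap.adjoint (𝕜 := ℝ) (E := Euc n) (F := Euc n)).continuous⟩

instance (n : ℕ) : MeasurableSpace (Orth n) := borel _

instance (n : ℕ) : BorelSpace (Orth n) := ⟨rfl⟩

instance (n : ℕ) : CompactSpace (Orth n) := by
  refine isCompact_iff_compactSpace.mp
    (Metric.isCompact_of_isClosed_isBounded isClosed_unitary ?_)
  refine (Metric.isBounded_closedBall (x := (0 : Euc n →L[ℝ] Euc n)) (r := 1)).subset ?_
  intro g hg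
  rw [mem_closedBall_zero_iff]
  refine ContinuousLinearMap.opNorm_le_bound _ zero_le_one fun x => ?_
  have := (Unitary.linearIsometryEquiv ⟨g, hg⟩).norm_map x
  rw [one_mul]
  exact this.le

/-- The action of the orthogonal group on `G(k, n)`: `(g, V) ↦ g(V)`. -/
def rotate {k n : ℕ} (g : Orth n) (V : Grass k (Euc n)) : Grass k (Euc n) :=
  ⟨V.space.map ((Unitary.linearIsometryEquiv g).toLinearEquiv : Euc n →ₗ[ℝ] Euc n), by
    rw [LinearEquiv.finrank_map_eq]; exact V.finrank_space⟩

/-- The span of the first `k` coordinate vectors of `ℝⁿ`. -/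
def coordPlane {k n : ℕ} (h : k ≤ n) : Grass k (Euc n) :=
  ⟨Submodule.span ℝ (Set.range fun i : Fin k => EuclideanSpace.single (Fin.castLE h i) (1 : ℝ)), by
    have hli : LinearIndependent ℝ
        (fun i : Fin k => EuclideanSpace.single (Fin.castLE h i) (1 : ℝ)) :=
      ((EuclideanSpace.orthonormal_single (𝕜 := ℝ) (ι := Fin n)).comp _
        (Fin.castLE_injective h)).linearIndependent
    rw [finrank_span_eq_card hli, Fintype.card_fin]⟩

/-- The rotation invariant probability measure on `G(k, n)`: the image of the normalized Haar
measure of the orthogonal group under `g ↦ g(V₀)`, where `V₀` is a coordinate `k`-plane. -/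
def grassMeasure {k n : ℕ} (h : k ≤ n) : Measure (Grass k (Euc n)) :=
  (Measure.haarMeasure (⊤ : TopologicalSpace.PositiveCompacts (Orth n))).map
    fun g => rotate g (coordPlane h)

theorem starProjection_rotate {k n : ℕ} (g : Orth n) (V : Grass k (Euc n)) :
    (rotate g V).space.starProjection =
      (g : Euc n →L[ℝ] Euc n) * V.space.starProjection * star (g : Euc n →L[ℝ] Euc n) := by
  ext1 x
  exact Submodule.starProjection_map_apply (Unitary.linearIsometryEquiv g) V.space x

theorem isometry_starProjection {k n : ℕ} :
    Isometry fun V : Grass k (Euc n) => V.space.starProjection :=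
  Isometry.of_dist_eq fun _ _ => dist_eq_norm _ _

/-- The orbit map is continuous, so the image measure above is the intended one. -/
theorem continuous_rotate {k n : ℕ} (V : Grass k (Euc n)) :
    Continuous fun g : Orth n => rotate g V := by
  rw [isometry_starProjection.isEmbedding.continuous_iff]
  simp only [Function.comp_def, starProjection_rotate]
  fun_prop

instance {k n : ℕ} (h : k ≤ n) : IsProbabilityMeasure (grassMeasure h) := by
  have : IsProbabilityMeasure
      (Measure.haarMeasure (⊤ : TopologicalSpace.PositiveCompacts (Orth n))) :=
    ⟨Measure.haarMeasure_self (K₀ := (⊤ : TopologicalSpace.PositiveCompacts (Orth n)))⟩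
  exact Measure.isProbabilityMeasure_map (continuous_rotate _).measurable.aemeasurable

theorem continuous_rotate_left {k n : ℕ} (g : Orth n) :
    Continuous fun V : Grass k (Euc n) => rotate g V := by
  rw [isometry_starProjection.isEmbedding.continuous_iff]
  simp only [Function.comp_def, starProjection_rotate]
  have := (isometry_starProjection (k := k) (n := n)).continuous
  fun_prop

/-- The measure on `G(k, n)` is invariant under the orthogonal group. -/
theorem map_rotate_grassMeasure {k n : ℕ} (h : k ≤ n) (g : Orth n) :
    (grassMeasure h).map (rotate g) = grassMeasure h := by
  have hg : Measurable fun x : Orth n => g * x := (continuous_const_mul g).measurable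
  have hr := (continuous_rotate (coordPlane h)).measurable
  unfold grassMeasure
  rw [Measure.map_map (continuous_rotate_left g).measurable hr]
  conv_rhs => rw [← map_mul_left_eq_self
    (Measure.haarMeasure (⊤ : TopologicalSpace.PositiveCompacts (Orth n))) g]
  rw [Measure.map_map hr hg]
  congr 1
  funext x
  apply isometry_starProjection.injective
  simp only [Function.comp_def, starProjection_rotate, Submonoid.coe_mul, star_mul, mul_assoc]

/-- `S(a) = inf_A esssup_V dim π_V(A)`, where `A` ranges over the Borel subsets of `A(1, n)` of
Hausdorff dimension `a`, and `V` over `G(k, n)` with its invariant probability measure. -/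
def S {k n : ℕ} (h : k ≤ n) (a : ℝ) : ℝ≥0∞ :=
  ⨅ (A : Set (AffGrass 1 (Euc n))) (_ : MeasurableSet A) (_ : dimH A = ENNReal.ofReal a),
    essSup (fun V : Grass k (Euc n) => dimTarget V.space (proj V.space '' A)) (grassMeasure h)

end LineProjection

end

noncomputable section

namespace LineProjection

open Set Filter Topology Metric
open scoped NNReal RealInnerProductSpace

/-! The infimum is tested on product families. A line is written as `x + ℝ v` with one coordinate of
`v` normalised to 1 and the same coordinate of `x` to 0; the other `n - 1` coordinates of `v` range
over a compact set of dimension `σ`, those of `x` over one of dimension `τ`. The family has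
dimension `(n - 1)(σ + τ)`. After projection to any `V`, directions account for at most `k - 1`
dimensions and positions for at most `(n - 1)τ`. If `a ≤ n - 1`, take `τ = 0`, as with lines through
one point; if `a ≥ n - 1`, take `σ = 1`, all directions, and let positions carry the remaining `a -
(n - 1)`. The bounds `a` and `2(k - 1)` are the trivial ones.

Hausdorff dimension need not be additive on products, so the factors carry stronger data: box counts
(`CoveringBound`) bound products from above in `dimH_pi_le`, Hölder parametrisations (`HolderParam`)
from below in `le_dimH_pi`. Self-similar Cantor sets have both. `dimH_lineSet_le` and
`le_dimH_lineSet` move between parameters and lines; `dimH_lineSet_le_of_snd_mem` counts directions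
in `V`. -/

/-! ### Dimension of products of sets of reals. -/

/-- For every `m`, the set `K` is covered by at most `C * 2 ^ (m * σ)` sets of diameter at most
`2 ^ (-m)`. -/
def CoveringBound (σ : ℝ≥0) (K : Set ℝ) : Prop :=
  ∃ C : ℝ≥0, ∀ m : ℕ, ∃ N : ℕ, (N : ℝ≥0) ≤ C * 2 ^ (m * σ : ℝ) ∧
    ∃ t : Fin N → Set ℝ, (∀ i, ediam (t i) ≤ (2⁻¹ : ℝ≥0∞) ^ m) ∧ K ⊆ ⋃ i, t i

/-- There is a measurable map from `[0, 1)` to `K` whose inverse is Hölder of exponent `σ`. -/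
def HolderParam (σ : ℝ≥0) (K : Set ℝ) : Prop :=
  ∃ h : ℝ → ℝ, Measurable h ∧ (∀ t ∈ Ico (0 : ℝ) 1, h t ∈ K) ∧
    ∃ C : ℝ≥0, ∀ t ∈ Ico (0 : ℝ) 1, ∀ t' ∈ Ico (0 : ℝ) 1,
      edist t t' ≤ C * edist (h t) (h t') ^ (σ : ℝ)

theorem prod_rpow_eq_rpow_sum {ι : Type*} (s : Finset ι) (σ : ι → ℝ≥0) (D : ℝ≥0∞) :
    ∏ i ∈ s, D ^ (σ i : ℝ) = D ^ ((∑ i ∈ s, σ i : ℝ≥0) : ℝ) := by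
  classical
  induction s using Finset.induction_on with
  | empty => simp
  | insert a s ha ih =>
    rw [Finset.prod_insert ha, Finset.sum_insert ha, ih, NNReal.coe_add,
      ENNReal.rpow_add_of_nonneg _ _ (σ a).coe_nonneg (NNReal.coe_nonneg _)]

/-- Products of the covering sets at one common scale `2 ^ (-m)` cover the product; their number
times their size to the power `∑ σ i` stays below `∏ C i` for every `m`. -/
theorem dimH_pi_le {ι : Type*} [Fintype ι] {σ : ι → ℝ≥0} {K : ι → Set ℝ}
    (h : ∀ i, CoveringBound (σ i) (K i)) :
    dimH (pi univ K) ≤ ((∑ i, σ i : ℝ≥0) : ℝ≥0∞) := by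
  classical
  choose C N hN t ht hK using h
  have hdiam : ∀ (m : ℕ) (f : ∀ i, Fin (N i m)),
      ediam (pi univ fun i => t i m (f i)) ≤ (2⁻¹ : ℝ≥0∞) ^ m := fun m f =>
    ediam_pi_le_of_le fun i => ht i m (f i)
  have hsum : ∀ m : ℕ, ∑ f : (∀ i, Fin (N i m)),
      ediam (pi univ fun i => t i m (f i)) ^ ((∑ i, σ i : ℝ≥0) : ℝ) ≤
        ((∏ i, C i : ℝ≥0) : ℝ≥0∞) := by
    intro m
    calc _ ≤ ∑ f : (∀ i, Fin (N i m)), ((2⁻¹ : ℝ≥0∞) ^ m) ^ ((∑ i, σ i : ℝ≥0) : ℝ) :=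
          Finset.sum_le_sum fun f _ => ENNReal.rpow_le_rpow (hdiam m f) (NNReal.coe_nonneg _)
      _ = ∏ i, ((N i m : ℝ≥0∞) * ((2⁻¹ : ℝ≥0∞) ^ m) ^ (σ i : ℝ)) := by
          rw [Finset.sum_const, Finset.card_univ, Fintype.card_pi, Finset.prod_mul_distrib,
            prod_rpow_eq_rpow_sum]
          simp
      _ ≤ ∏ i, (C i : ℝ≥0∞) := by
          refine Finset.prod_le_prod' fun i _ => ?_
          have h2 : ((2⁻¹ : ℝ≥0∞) ^ m) ^ (σ i : ℝ) =
              (((2 : ℝ≥0) ^ (m * σ i : ℝ))⁻¹ : ℝ≥0) := by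
            rw [← ENNReal.rpow_natCast, ← ENNReal.rpow_mul, ENNReal.inv_rpow,
              ENNReal.coe_inv (by positivity),
              ENNReal.coe_rpow_of_ne_zero two_ne_zero]
            simp
          rw [h2, ← ENNReal.coe_natCast, ← ENNReal.coe_mul, ENNReal.coe_le_coe]
          rw [← div_eq_mul_inv]
          exact div_le_of_le_mul₀ (by positivity) (by positivity) (hN i m)
      _ = _ := by push_cast; rfl
  refine dimH_le_of_hausdorffMeasure_ne_top (d := ∑ i, σ i) (ne_top_of_le_ne_top
    (b := ((∏ i, C i : ℝ≥0) : ℝ≥0∞)) ENNReal.coe_ne_top ?_)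
  refine (Measure.hausdorffMeasure_le_liminf_sum (β := ℕ) (l := atTop) _ _
    (fun m => (2⁻¹ : ℝ≥0∞) ^ m) (ENNReal.tendsto_pow_atTop_nhds_zero_of_lt_one (by simp))
    (fun m (f : ∀ i, Fin (N i m)) => pi univ fun i => t i m (f i))
    (Eventually.of_forall hdiam) (Eventually.of_forall fun m y hy => ?_)).trans ?_
  · have : ∀ i, ∃ j, y i ∈ t i m j := fun i => mem_iUnion.mp (hK i m (hy i (mem_univ i)))
    choose f hf using this
    exact mem_iUnion.mpr ⟨f, fun i _ => hf i⟩
  · exact liminf_le_of_frequently_le' (Frequently.of_forall hsum)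

/-- Mass distribution principle for the push-forward of Lebesgue measure on the unit cube: the
volume of a preimage is at most the product of the diameters of its coordinate projections, and each
of these is controlled by the Hölder bound. -/
theorem le_dimH_pi {ι : Type*} [Fintype ι] {σ : ι → ℝ≥0} {K : ι → Set ℝ}
    (H : ∀ i, HolderParam (σ i) (K i)) :
    ((∑ i, σ i : ℝ≥0) : ℝ≥0∞) ≤ dimH (pi univ K) := by
  choose h hm hK C hC using H
  let F : (ι → ℝ) → ι → ℝ := fun y i => h i (y i)
  have hF : Measurable F := measurable_pi_lambda _ fun i => (hm i).comp (measurable_pi_apply i)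
  let Q : Set (ι → ℝ) := pi univ fun _ => Ico 0 1
  have hQ : volume Q = 1 := by simp [Q, volume_pi_pi]
  let μ : Measure (ι → ℝ) := (volume.restrict Q).map F
  -- The `+ 1` only keeps the constant invertible.
  let c : ℝ≥0 := ∏ i, C i + 1
  have hc : (c : ℝ≥0∞) ≠ 0 := by simp [c]
  have hμ : ∀ s, μ s ≤ c * ediam s ^ ((∑ i, σ i : ℝ≥0) : ℝ) := by
    intro s
    -- The closure is measurable and has the same diameter.
    calc μ s ≤ μ (closure s) := measure_mono subset_closure
      _ = volume (F ⁻¹' closure s ∩ Q) := by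
          rw [Measure.map_apply hF isClosed_closure.measurableSet,
            Measure.restrict_apply (hF isClosed_closure.measurableSet)]
      _ ≤ ∏ i, ediam (Function.eval i '' (F ⁻¹' closure s ∩ Q)) := Real.volume_pi_le_prod_diam _
      _ ≤ ∏ i, (C i * ediam s ^ (σ i : ℝ)) := by
          refine Finset.prod_le_prod' fun i _ => ediam_le ?_
          rintro _ ⟨y, ⟨hy, hyQ⟩, rfl⟩ _ ⟨z, ⟨hz, hzQ⟩, rfl⟩
          refine (hC i _ (hyQ i (mem_univ i)) _ (hzQ i (mem_univ i))).trans ?_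
          gcongr
          calc edist (F y i) (F z i) ≤ edist (F y) (F z) := edist_le_pi_edist _ _ i
            _ ≤ ediam (closure s) := edist_le_ediam_of_mem hy hz
            _ = ediam s := ediam_closure s
      _ = (∏ i, (C i : ℝ≥0∞)) * ediam s ^ ((∑ i, σ i : ℝ≥0) : ℝ) := by
          rw [Finset.prod_mul_distrib, prod_rpow_eq_rpow_sum]
      _ ≤ _ := by
          gcongr
          simp [c]
  have hle : (c : ℝ≥0∞)⁻¹ • μ ≤ Measure.hausdorffMeasure ((∑ i, σ i : ℝ≥0) : ℝ) := by
    refine Measure.le_hausdorffMeasure _ _ 1 one_pos fun s _ => ?_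
    rw [Measure.smul_apply, smul_eq_mul]
    calc _ ≤ (c : ℝ≥0∞)⁻¹ * (c * ediam s ^ ((∑ i, σ i : ℝ≥0) : ℝ)) := by gcongr; exact hμ s
      _ = _ := by rw [← mul_assoc, ENNReal.inv_mul_cancel hc ENNReal.coe_ne_top, one_mul]
  have h1 : 1 ≤ μ (pi univ K) := by
    refine le_trans ?_ (Measure.le_map_apply hF.aemeasurable _)
    rw [Measure.restrict_apply_superset, hQ]
    exact fun y hy i _ => hK i _ (hy i (mem_univ i))
  refine le_dimH_of_hausdorffMeasure_ne_zero fun h0 => ?_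
  have h2 := hle (pi univ K)
  rw [h0, Measure.smul_apply, smul_eq_mul, nonpos_iff_eq_zero, mul_eq_zero] at h2
  rcases h2 with h2 | h2
  · simp at h2
  · rw [h2] at h1; simp at h1

/-! ### Compact sets of reals of prescribed dimension. -/

theorem coveringBound_singleton (x : ℝ) : CoveringBound 0 {x} :=
  ⟨1, fun m => ⟨1, by simp, fun _ => {x}, by simp, by simp⟩⟩

theorem holderParam_singleton (x : ℝ) : HolderParam 0 {x} := by
  refine ⟨fun _ => x, measurable_const, by simp, 1, fun t ht t' ht' => ?_⟩
  -- With exponent `0` the right side of the Hölder bound is `1`, since `0 ^ 0 = 1`.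
  have : |t - t'| ≤ 1 := abs_le.mpr ⟨by linarith [ht.1, ht'.2], by linarith [ht.2, ht'.1]⟩
  simpa [edist_dist, Real.dist_eq] using this

theorem coveringBound_Icc_zero_one : CoveringBound 1 (Icc 0 1) := by
  -- The additional interval catches the endpoint `1`.
  refine ⟨2, fun m => ⟨2 ^ m + 1, ?_, fun i => Icc (i / 2 ^ m) ((i + 1) / 2 ^ m), fun i => ?_, ?_⟩⟩
  · have : (1 : ℝ≥0) ≤ 2 ^ m := one_le_pow₀ one_le_two
    simp only [NNReal.coe_one, mul_one, NNReal.rpow_natCast]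
    push_cast
    linarith
  · rw [Real.ediam_Icc, ← sub_div, add_sub_cancel_left, ← ENNReal.inv_pow, one_div,
      ENNReal.ofReal_inv_of_pos (by positivity), ENNReal.ofReal_pow zero_le_two]
    simp
  · intro x hx
    have h2 : (0 : ℝ) < 2 ^ m := by positivity
    have hlt : ⌊x * 2 ^ m⌋₊ < 2 ^ m + 1 := by
      rw [Nat.floor_lt (mul_nonneg hx.1 h2.le)]
      push_cast
      nlinarith [hx.2]
    refine mem_iUnion.mpr ⟨⟨_, hlt⟩, ?_, ?_⟩
    · rw [div_le_iff₀ h2]; exact Nat.floor_le (mul_nonneg hx.1 h2.le)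
    · rw [le_div_iff₀ h2]; exact (Nat.lt_floor_add_one _).le

theorem holderParam_Icc_zero_one : HolderParam 1 (Icc 0 1) :=
  ⟨id, measurable_id, fun _ ht => ⟨ht.1, ht.2.le⟩, 1, fun t _ t' _ => by simp⟩

theorem coveringBound_Icc_neg_one_one : CoveringBound 1 (Icc (-1) 1) := by
  obtain ⟨C, hC⟩ := coveringBound_Icc_zero_one
  refine ⟨2 * C, fun m => ?_⟩
  obtain ⟨N, hN, t, ht, hcov⟩ := hC m
  refine ⟨N + N, ?_, Fin.append t fun i => Neg.neg '' t i, fun i => ?_, fun x hx => ?_⟩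
  · push_cast
    rw [two_mul, add_mul]
    exact add_le_add hN hN
  · refine Fin.addCases (fun j => ?_) (fun j => ?_) i
    · simpa using ht j
    · rw [Fin.append_right]
      exact ((IsometryEquiv.neg ℝ).isometry.ediam_image (t j)).trans_le (ht j)
  · rcases le_total 0 x with h | h
    · obtain ⟨i, hi⟩ := mem_iUnion.mp (hcov ⟨h, hx.2⟩)
      exact mem_iUnion.mpr ⟨Fin.castAdd N i, by simpa using hi⟩
    · obtain ⟨i, hi⟩ := mem_iUnion.mp (hcov ⟨neg_nonneg.mpr h, by linarith [hx.1]⟩)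
      exact mem_iUnion.mpr ⟨Fin.natAdd N i, by rw [Fin.append_right]; exact ⟨-x, hi, neg_neg x⟩⟩

/-- The expansion `∑ i, (1 - c) c ^ i εᵢ`, where the `εᵢ` are the binary digits of `t`. -/
def cantorMap (c t : ℝ) : ℝ := ∑' i : ℕ, (1 - c) * c ^ i * ((⌊2 ^ (i + 1) * t⌋ % 2 : ℤ) : ℝ)

theorem intCast_emod_two_mem_Icc (z : ℤ) : ((z % 2 : ℤ) : ℝ) ∈ Icc (0 : ℝ) 1 := by
  rcases Int.emod_two_eq_zero_or_one z with h | h <;> simp [h]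

section

variable {c : ℝ}

theorem cantorMap_hasSum (h0 : 0 ≤ c) (h1 : c < 1) (t : ℝ) :
    HasSum (fun i : ℕ => (1 - c) * c ^ i * ((⌊2 ^ (i + 1) * t⌋ % 2 : ℤ) : ℝ))
      (cantorMap c t) := by
  refine (Summable.of_nonneg_of_le (fun i => ?_) (fun i => ?_)
    ((summable_geometric_of_lt_one h0 h1).mul_left (1 - c))).hasSum
  · exact mul_nonneg (mul_nonneg (by linarith) (pow_nonneg h0 i)) (intCast_emod_two_mem_Icc _).1
  · exact mul_le_of_le_one_right (mul_nonneg (by linarith) (pow_nonneg h0 i))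
      (intCast_emod_two_mem_Icc _).2

theorem cantorMap_mem_Icc (h0 : 0 ≤ c) (h1 : c < 1) (t : ℝ) : cantorMap c t ∈ Icc (0 : ℝ) 1 := by
  have hs := cantorMap_hasSum h0 h1 t
  have hg := (hasSum_geometric_of_lt_one h0 h1).mul_left (1 - c)
  rw [mul_inv_cancel₀ (by linarith)] at hg
  exact ⟨hs.nonneg fun i => mul_nonneg (mul_nonneg (by linarith) (pow_nonneg h0 i))
      (intCast_emod_two_mem_Icc _).1,
    hasSum_le (fun i => mul_le_of_le_one_right (mul_nonneg (by linarith) (pow_nonneg h0 i))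
      (intCast_emod_two_mem_Icc _).2) hs hg⟩

theorem measurable_cantorMap (h0 : 0 ≤ c) (h1 : c < 1) : Measurable (cantorMap c) := by
  refine measurable_of_tendsto_metrizable (f := fun (n : ℕ) t => ∑ i ∈ Finset.range n,
    (1 - c) * c ^ i * ((⌊2 ^ (i + 1) * t⌋ % 2 : ℤ) : ℝ)) (fun n => ?_)
    (tendsto_pi_nhds.mpr fun t => (cantorMap_hasSum h0 h1 t).tendsto_sum_nat)
  refine Finset.measurable_sum _ fun i _ => Measurable.const_mul ?_ _
  exact (measurable_from_top (f := fun z : ℤ => ((z % 2 : ℤ) : ℝ))).comp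
    (Int.measurable_floor.comp (measurable_id.const_mul _))

/-- Self-similarity, from splitting off the leading binary digit; on each half of `[0, 1)` it
becomes one of the two contractions by `c`. -/
theorem cantorMap_eq (h0 : 0 ≤ c) (h1 : c < 1) (t : ℝ) :
    cantorMap c t = (1 - c) * ((⌊2 * t⌋ % 2 : ℤ) : ℝ) + c * cantorMap c (2 * t) := by
  have hs := cantorMap_hasSum h0 h1 t
  rw [← hs.tsum_eq, hs.summable.tsum_eq_zero_add,
    ← ((cantorMap_hasSum h0 h1 (2 * t)).mul_left c).tsum_eq]
  congr 1
  · simp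
  · refine tsum_congr fun i => ?_
    rw [pow_succ 2 (i + 1), mul_assoc (2 ^ (i + 1) : ℝ) 2 t]
    ring

theorem cantorMap_sub_one (c t : ℝ) : cantorMap c (t - 1) = cantorMap c t := by
  refine tsum_congr fun i => ?_
  have : (2 : ℝ) ^ (i + 1) * (t - 1) = 2 ^ (i + 1) * t - ((2 * 2 ^ i : ℤ) : ℝ) := by
    push_cast; ring
  rw [this, Int.floor_sub_intCast, Int.sub_mul_emod_self_left]

theorem cantorMap_of_lt_half (h0 : 0 ≤ c) (h1 : c < 1) {t : ℝ} (ht0 : 0 ≤ t) (ht : t < 1 / 2) :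
    cantorMap c t = c * cantorMap c (2 * t) := by
  have : ⌊2 * t⌋ = 0 := Int.floor_eq_iff.mpr ⟨by push_cast; linarith, by push_cast; linarith⟩
  rw [cantorMap_eq h0 h1, this]; simp

theorem cantorMap_of_half_le (h0 : 0 ≤ c) (h1 : c < 1) {t : ℝ} (ht0 : 1 / 2 ≤ t) (ht : t < 1) :
    cantorMap c t = (1 - c) + c * cantorMap c (2 * t - 1) := by
  have : ⌊2 * t⌋ = 1 := Int.floor_eq_iff.mpr ⟨by push_cast; linarith, by push_cast; linarith⟩
  rw [cantorMap_eq h0 h1, this, cantorMap_sub_one]; simp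

/-- Induction on the scale of `t' - t`. If both points lie in one half, doubling reduces to the
previous scale, and `c ^ σ = 1 / 2` makes both sides halve. If they lie in different halves, the
images are separated by the central gap `1 - 2 * c`. -/
theorem cantorMap_expand (h0 : 0 < c) (h2 : c < 1 / 2) {σ : ℝ} (hσ : 0 ≤ σ)
    (hc : c ^ σ = 1 / 2) (n : ℕ) :
    ∀ t t' : ℝ, 0 ≤ t → t < t' → t' < 1 → 1 ≤ 2 ^ n * (t' - t) →
      cantorMap c t < cantorMap c t' ∧
      (t' - t) * (1 - 2 * c) ^ σ ≤ (cantorMap c t' - cantorMap c t) ^ σ := by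
  have h1 : c < 1 := by linarith
  have scale : ∀ x y s : ℝ, x < y → s * (1 - 2 * c) ^ σ ≤ (y - x) ^ σ →
      s / 2 * (1 - 2 * c) ^ σ ≤ (c * y - c * x) ^ σ := by
    intro x y s hxy h
    rw [← mul_sub, Real.mul_rpow h0.le (by linarith), hc]
    linarith
  induction n with
  | zero => intro t t' h0 h1 h2 h3; simp at h3; linarith
  | succ n ih =>
    intro t t' ht htt ht' hn
    rw [pow_succ] at hn
    rcases lt_or_ge t' (1 / 2) with h | h
    · obtain ⟨ha, hb⟩ := ih (2 * t) (2 * t') (by linarith) (by linarith) (by linarith) (by linarith)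
      rw [cantorMap_of_lt_half h0.le h1 ht (by linarith),
        cantorMap_of_lt_half h0.le h1 (by linarith) h]
      refine ⟨by gcongr, ?_⟩
      convert scale _ _ _ ha hb using 2
      ring
    rcases lt_or_ge t (1 / 2) with h' | h'
    · rw [cantorMap_of_lt_half h0.le h1 ht h', cantorMap_of_half_le h0.le h1 h ht']
      -- The left image lies below `c`, the right one above `1 - c`.
      have ha := mul_le_mul_of_nonneg_left (cantorMap_mem_Icc h0.le h1 (2 * t)).2 h0.le
      have hb := mul_nonneg h0.le (cantorMap_mem_Icc h0.le h1 (2 * t' - 1)).1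
      refine ⟨by linarith, ?_⟩
      have hp : 0 ≤ (1 - 2 * c) ^ σ := Real.rpow_nonneg (by linarith) _
      calc (t' - t) * (1 - 2 * c) ^ σ ≤ 1 * (1 - 2 * c) ^ σ := by gcongr; linarith
        _ = (1 - 2 * c) ^ σ := one_mul _
        _ ≤ _ := Real.rpow_le_rpow (by linarith) (by linarith) hσ
    · obtain ⟨ha, hb⟩ := ih (2 * t - 1) (2 * t' - 1) (by linarith) (by linarith) (by linarith)
        (by linarith)
      rw [cantorMap_of_half_le h0.le h1 h' (by linarith), cantorMap_of_half_le h0.le h1 h ht']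
      refine ⟨by gcongr, ?_⟩
      rw [add_sub_add_left_eq_sub]
      convert scale _ _ _ ha hb using 2
      ring

theorem edist_le_cantorMap (h0 : 0 < c) (h2 : c < 1 / 2) {σ : ℝ} (hσ : 0 ≤ σ)
    (hc : c ^ σ = 1 / 2) {t t' : ℝ} (ht : t ∈ Ico (0 : ℝ) 1) (ht' : t' ∈ Ico (0 : ℝ) 1) :
    edist t t' ≤ ((1 - 2 * c) ^ σ)⁻¹.toNNReal * edist (cantorMap c t) (cantorMap c t') ^ σ := by
  have hp : 0 < (1 - 2 * c) ^ σ := Real.rpow_pos_of_pos (by linarith) _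
  wlog hlt : t < t' generalizing t t'
  · rcases (not_lt.mp hlt).eq_or_lt with rfl | h
    · simp
    · rw [edist_comm, edist_comm (cantorMap c t)]
      exact this ht' ht h
  obtain ⟨n, hn⟩ := pow_unbounded_of_one_lt (t' - t)⁻¹ (one_lt_two : (1 : ℝ) < 2)
  have hpos : 0 < t' - t := by linarith
  obtain ⟨ha, hb⟩ := cantorMap_expand h0 h2 hσ hc n t t' ht.1 hlt ht'.2 (by
    rw [inv_lt_iff_one_lt_mul₀ hpos] at hn; linarith)
  rw [edist_comm, edist_comm (cantorMap c t), edist_dist, edist_dist, Real.dist_eq, Real.dist_eq,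
    abs_of_pos hpos, abs_of_pos (by linarith), ENNReal.ofReal_rpow_of_nonneg (by linarith) hσ]
  change _ ≤ ENNReal.ofReal _ * _
  rw [← ENNReal.ofReal_mul (by positivity), inv_mul_eq_div]
  exact ENNReal.ofReal_le_ofReal ((le_div_iff₀ hp).mpr hb)

theorem cantorMap_image_cover (h0 : 0 ≤ c) (h1 : c < 1) (j : ℕ) :
    ∃ a : Fin (2 ^ j) → ℝ,
      cantorMap c '' Ico 0 1 ⊆ ⋃ i, Icc (a i) (a i + c ^ j) := by
  induction j with
  | zero =>
    refine ⟨fun _ => 0, ?_⟩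
    rintro _ ⟨t, -, rfl⟩
    exact mem_iUnion.mpr ⟨0, by simpa using cantorMap_mem_Icc h0 h1 t⟩
  | succ j ih =>
    obtain ⟨a, ha⟩ := ih
    rw [pow_succ, mul_two]
    refine ⟨Fin.append (fun i => c * a i) (fun i => (1 - c) + c * a i), ?_⟩
    rintro _ ⟨t, ht, rfl⟩
    rcases lt_or_ge t (1 / 2) with h | h
    · obtain ⟨i, hi⟩ := mem_iUnion.mp (ha ⟨2 * t, ⟨by linarith [ht.1], by linarith⟩, rfl⟩)
      refine mem_iUnion.mpr ⟨Fin.castAdd _ i, ?_⟩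
      rw [Fin.append_left, cantorMap_of_lt_half h0 h1 ht.1 h]
      have := mul_le_mul_of_nonneg_left hi.1 h0
      have := mul_le_mul_of_nonneg_left hi.2 h0
      exact ⟨by linarith, by rw [pow_succ]; linarith⟩
    · obtain ⟨i, hi⟩ := mem_iUnion.mp (ha ⟨2 * t - 1, ⟨by linarith, by linarith [ht.2]⟩, rfl⟩)
      refine mem_iUnion.mpr ⟨Fin.natAdd _ i, ?_⟩
      rw [Fin.append_right, cantorMap_of_half_le h0 h1 h ht.2]
      have := mul_le_mul_of_nonneg_left hi.1 h0
      have := mul_le_mul_of_nonneg_left hi.2 h0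
      exact ⟨by linarith, by rw [pow_succ]; linarith⟩

end

/-- For every `σ ∈ [0, 1]` there is a compact set of reals of box and Hausdorff dimension `σ`. -/
theorem exists_isCompact_coveringBound_holderParam {σ : ℝ≥0} (hσ : σ ≤ 1) :
    ∃ K : Set ℝ, IsCompact K ∧ CoveringBound σ K ∧ HolderParam σ K := by
  rcases eq_or_ne σ 0 with rfl | h0
  · exact ⟨{0}, isCompact_singleton, coveringBound_singleton 0, holderParam_singleton 0⟩
  rcases eq_or_lt_of_le hσ with rfl | h1
  · exact ⟨Icc 0 1, isCompact_Icc, coveringBound_Icc_zero_one, holderParam_Icc_zero_one⟩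
  have hpos : (0 : ℝ) < σ := NNReal.coe_pos.mpr (pos_iff_ne_zero.mpr h0)
  have hlt : (σ : ℝ) < 1 := by exact_mod_cast h1
  -- This ratio solves `c ^ σ = 1 / 2`; `σ < 1` gives `c < 1 / 2`, hence a genuine gap.
  set c : ℝ := (1 / 2) ^ (1 / (σ : ℝ)) with hcdef
  have hc0 : 0 < c := by positivity
  have hcσ : c ^ (σ : ℝ) = 1 / 2 := by
    rw [hcdef, ← Real.rpow_mul (by norm_num), one_div_mul_cancel hpos.ne', Real.rpow_one]
  have hc2 : c < 1 / 2 := by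
    conv_rhs => rw [← Real.rpow_one (1 / 2)]
    exact Real.rpow_lt_rpow_of_exponent_gt (by norm_num) (by norm_num)
      ((one_lt_div hpos).mpr hlt)
  have hc1 : c < 1 := by linarith
  refine ⟨closure (cantorMap c '' Ico 0 1), ?_, ⟨2, fun m => ?_⟩, cantorMap c,
    measurable_cantorMap hc0.le hc1, fun t ht => subset_closure ⟨t, ht, rfl⟩, _,
    fun t ht t' ht' => edist_le_cantorMap hc0 hc2 hpos.le hcσ ht ht'⟩
  · refine isCompact_Icc.of_isClosed_subset isClosed_closure (closure_minimal ?_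
      (isClosed_Icc (a := (0 : ℝ)) (b := 1)))
    rintro _ ⟨t, -, rfl⟩
    exact cantorMap_mem_Icc hc0.le hc1 t
  -- As `c ^ j = 2 ^ (-j / σ)`, this is the first level whose intervals have length at most `2 ^
  -- (-m)`. Rounding up costs the factor `2`.
  · set j : ℕ := ⌈m * (σ : ℝ)⌉₊ with hj
    obtain ⟨a, ha⟩ := cantorMap_image_cover hc0.le hc1 j
    refine ⟨2 ^ j, ?_, fun i => Icc (a i) (a i + c ^ j), fun i => ?_,
      closure_minimal ha (isClosed_iUnion_of_finite fun i => isClosed_Icc)⟩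
    · have h := (Nat.ceil_lt_add_one (a := m * (σ : ℝ)) (by positivity)).le
      rw [← hj] at h
      rw [← NNReal.coe_le_coe]
      push_cast
      calc (2 : ℝ) ^ j = 2 ^ (j : ℝ) := (Real.rpow_natCast _ _).symm
        _ ≤ 2 ^ (m * (σ : ℝ) + 1) := Real.rpow_le_rpow_of_exponent_le one_le_two h
        _ = _ := by rw [Real.rpow_add two_pos, Real.rpow_one, mul_comm]
    · have h : c ^ j ≤ (2⁻¹ : ℝ) ^ m := by
        rw [← Real.rpow_natCast, hcdef, ← Real.rpow_mul (by norm_num), ← Real.rpow_natCast,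
          one_div 2]
        refine Real.rpow_le_rpow_of_exponent_ge (by norm_num) (by norm_num) ?_
        rw [one_div_mul_eq_div, le_div_iff₀ hpos]
        exact Nat.le_ceil _
      rw [Real.ediam_Icc, add_sub_cancel_left]
      calc ENNReal.ofReal (c ^ j) ≤ ENNReal.ofReal ((2⁻¹ : ℝ) ^ m) := ENNReal.ofReal_le_ofReal h
        _ = _ := by
          rw [ENNReal.ofReal_pow (by norm_num), ENNReal.ofReal_inv_of_pos two_pos]
          simp

/-! ### Dimension of families of lines. -/

theorem dimH_image_le_of_contDiffAt {E F : Type*} [NormedAddCommGroup E] [NormedSpace ℝ E]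
    [SecondCountableTopology E] [NormedAddCommGroup F] [NormedSpace ℝ F] {f : E → F} {s : Set E}
    (hf : ∀ x ∈ s, ContDiffAt ℝ 1 f x) : dimH (f '' s) ≤ dimH s := by
  refine dimH_image_le_of_locally_lipschitzOn fun x hx => ?_
  obtain ⟨C, t, ht, hC⟩ := (hf x hx).exists_lipschitzOnWith
  exact ⟨C, t, mem_nhdsWithin_of_mem_nhds ht, hC⟩

theorem sum_ite_eq_zero_one {k : ℕ} (i : Fin k) (a : ℝ≥0) :
    ∑ j : Fin k, (if j = i then 0 else a) = ((k - 1 : ℕ) : ℝ≥0) * a := by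
  rw [← Finset.add_sum_erase _ _ (Finset.mem_univ i), if_pos rfl, zero_add,
    Finset.sum_congr rfl fun j hj => if_neg (Finset.ne_of_mem_erase hj), Finset.sum_const,
    Finset.card_erase_of_mem (Finset.mem_univ i), Finset.card_univ, Fintype.card_fin, nsmul_eq_mul]

section Lines

variable {V : Type*} [NormedAddCommGroup V] [InnerProductSpace ℝ V]

/-- The lines through `x` with direction `v`, for `(v, x) ∈ Q` with `v ≠ 0`. -/
def lineSet (Q : Set (V × V)) : Set (AffGrass 1 V) :=
  {L | ∃ p ∈ Q, L.plane = AffineSubspace.mk' p.2 (ℝ ∙ p.1)}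

/-- The coordinates of the line through `p.2` with direction `p.1`. -/
def lineCoords (p : V × V) : (V →L[ℝ] V) × V :=
  ((‖p.1‖ ^ 2)⁻¹ • (innerSL ℝ p.1).smulRight p.1, p.2 - (⟪p.1, p.2⟫ / ‖p.1‖ ^ 2) • p.1)

theorem fst_ne_zero_of_plane_eq {L : AffGrass 1 V} {p : V × V}
    (h : L.plane = AffineSubspace.mk' p.2 (ℝ ∙ p.1)) : p.1 ≠ 0 := by
  intro h0
  have := L.finrank_direction
  rw [h, AffineSubspace.direction_mk', h0, Submodule.span_zero_singleton, finrank_bot] at this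
  exact zero_ne_one this

theorem contDiffAt_lineCoords {p : V × V} (hp : p.1 ≠ 0) : ContDiffAt ℝ 1 lineCoords p := by
  have h0 : ‖p.1‖ ^ 2 ≠ 0 := pow_ne_zero 2 (norm_ne_zero_iff.mpr hp)
  have h1 : ContDiffAt ℝ 1 (fun q : V × V => ‖q.1‖ ^ 2) p := contDiffAt_fst.norm_sq ℝ
  have h2 : ContDiffAt ℝ 1 (fun q : V × V => innerSL ℝ q.1) p :=
    (innerSL ℝ).contDiff.contDiffAt.comp p contDiffAt_fst
  exact ((h1.inv h0).smul (h2.smulRight contDiffAt_fst)).prodMk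
    (contDiffAt_snd.sub (((contDiffAt_fst.inner ℝ contDiffAt_snd).div h1 h0).smul contDiffAt_fst))

theorem mk'_span_singleton_eq (v x : V) {c : ℝ} (hc : c ≠ 0) (s : ℝ) :
    AffineSubspace.mk' (x + s • v) (ℝ ∙ (c • v)) = AffineSubspace.mk' x (ℝ ∙ v) := by
  rw [Submodule.span_singleton_smul_eq hc.isUnit]
  refine AffineSubspace.ext_of_direction_eq (by simp) ⟨x + s • v,
    AffineSubspace.self_mem_mk' _ _, ?_⟩
  simpa [AffineSubspace.mem_mk'] using
    Submodule.smul_mem _ s (Submodule.mem_span_singleton_self v)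

variable [FiniteDimensional ℝ V]

/-- The projection onto the direction of a line, together with the foot of the line. -/
def coords (L : AffGrass 1 V) : (V →L[ℝ] V) × V := (L.plane.direction.starProjection, L.foot)

theorem AffGrass.foot_eq {l : ℕ} (L : AffGrass l V) {x : V} (hx : x ∈ L.plane) :
    L.foot = x - L.plane.direction.starProjection x := by
  have : Nonempty L.plane := L.nonempty.to_subtype
  refine EuclideanGeometry.coe_orthogonalProjection_eq_iff_mem.mpr ⟨?_, ?_⟩
  · have h := AffineSubspace.vadd_mem_of_mem_direction
      (neg_mem (L.plane.direction.starProjection_apply_mem x)) hx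
    rwa [vadd_eq_add, neg_add_eq_sub] at h
  · rw [vsub_eq_sub, zero_sub]
    exact neg_mem (Submodule.sub_starProjection_mem_orthogonal x)

theorem lipschitzWith_coords : LipschitzWith 1 (coords : AffGrass 1 V → _) := by
  refine LipschitzWith.of_dist_le_mul fun L M => ?_
  rw [Prod.dist_eq, NNReal.coe_one, one_mul, dist_eq_norm, dist_eq_norm]
  exact max_le (le_add_of_nonneg_right (norm_nonneg _)) (le_add_of_nonneg_left (norm_nonneg _))

/-- With `lipschitzWith_coords`, this makes `coords` bi-Lipschitz onto its image, so dimensions can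
be computed in a normed space, where smooth maps are available. -/
theorem antilipschitzWith_coords : AntilipschitzWith 2 (coords : AffGrass 1 V → _) := by
  refine AntilipschitzWith.of_le_mul_dist fun L M => ?_
  rw [Prod.dist_eq, NNReal.coe_ofNat, two_mul, dist_eq_norm (coords L).1,
    dist_eq_norm (coords L).2]
  exact add_le_add (le_max_left _ _) (le_max_right _ _)

theorem coords_eq_lineCoords {L : AffGrass 1 V} {p : V × V}
    (h : L.plane = AffineSubspace.mk' p.2 (ℝ ∙ p.1)) : coords L = lineCoords p := by
  have hx : p.2 ∈ L.plane := h ▸ AffineSubspace.self_mem_mk' _ _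
  have hP : L.plane.direction.starProjection = (ℝ ∙ p.1).starProjection :=
    Submodule.starProjection_inj.mpr (by rw [h, AffineSubspace.direction_mk'])
  refine Prod.ext ?_ ?_
  · ext w
    simp [coords, lineCoords, hP, Submodule.starProjection_singleton, div_eq_inv_mul, smul_smul]
  · simp [coords, lineCoords, L.foot_eq hx, hP, Submodule.starProjection_singleton]

theorem coords_image_lineSet (Q : Set (V × V)) :
    coords '' lineSet Q = lineCoords '' {p ∈ Q | p.1 ≠ 0} := by
  ext z
  constructor
  · rintro ⟨L, ⟨p, hp, h⟩, rfl⟩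
    exact ⟨p, ⟨hp, fst_ne_zero_of_plane_eq h⟩, (coords_eq_lineCoords h).symm⟩
  · rintro ⟨p, ⟨hp, h0⟩, rfl⟩
    let L : AffGrass 1 V := ⟨AffineSubspace.mk' p.2 (ℝ ∙ p.1), AffineSubspace.mk'_nonempty _ _, by
      rw [AffineSubspace.direction_mk', finrank_span_singleton h0]⟩
    exact ⟨L, ⟨p, hp, rfl⟩, coords_eq_lineCoords (L := L) rfl⟩

theorem dimH_lineSet_le (Q : Set (V × V)) : dimH (lineSet Q) ≤ dimH Q :=
  calc dimH (lineSet Q) ≤ dimH (coords '' lineSet Q) := antilipschitzWith_coords.le_dimH_image _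
    _ = dimH (lineCoords '' {p ∈ Q | p.1 ≠ 0}) := by rw [coords_image_lineSet]
    _ ≤ dimH {p ∈ Q | p.1 ≠ 0} :=
      dimH_image_le_of_contDiffAt fun _ hp => contDiffAt_lineCoords hp.2
    _ ≤ dimH Q := dimH_mono (sep_subset _ _)

/-- The normalisation makes `(v, x)` a smooth function of the line: `v` is `P e` divided by `⟪e, P
e⟫`, where `P` projects onto the direction, and `x` is the foot slid along `v` into the hyperplane
orthogonal to `e`. -/
theorem le_dimH_lineSet (e : V) {Q : Set (V × V)}
    (hQ : ∀ p ∈ Q, ⟪e, p.1⟫ = 1 ∧ ⟪e, p.2⟫ = 0) : dimH Q ≤ dimH (lineSet Q) := by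
  let G₁ : (V →L[ℝ] V) × V → V := fun z => (⟪e, z.1 e⟫)⁻¹ • z.1 e
  let G : (V →L[ℝ] V) × V → V × V := fun z => (G₁ z, z.2 - ⟪e, z.2⟫ • G₁ z)
  have key : ∀ p ∈ Q, p.1 ≠ 0 ∧ (lineCoords p).1 e = (‖p.1‖ ^ 2)⁻¹ • p.1 := by
    intro p hp
    refine ⟨fun h => ?_, ?_⟩
    · have := (hQ p hp).1
      rw [h, inner_zero_right] at this
      exact zero_ne_one this
    · simp [lineCoords, real_inner_comm e, (hQ p hp).1]
  have hne : ∀ p ∈ Q, ⟪e, (lineCoords p).1 e⟫ = (‖p.1‖ ^ 2)⁻¹ := fun p hp => by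
    rw [(key p hp).2, inner_smul_right, (hQ p hp).1, mul_one]
  have hpos : ∀ p ∈ Q, ‖p.1‖ ^ 2 ≠ 0 := fun p hp =>
    pow_ne_zero 2 (norm_ne_zero_iff.mpr (key p hp).1)
  have hG₁ : ∀ p ∈ Q, G₁ (lineCoords p) = p.1 := fun p hp => by
    simp only [G₁]
    rw [hne p hp, (key p hp).2, inv_inv, smul_smul, mul_inv_cancel₀ (hpos p hp), one_smul]
  have hG : ∀ p ∈ Q, G (lineCoords p) = p := fun p hp => by
    refine Prod.ext (hG₁ p hp) ?_
    simp only [G, hG₁ p hp]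
    simp [lineCoords, inner_sub_right, inner_smul_right, (hQ p hp).1, (hQ p hp).2]
  have hsmooth : ∀ z : (V →L[ℝ] V) × V, ⟪e, z.1 e⟫ ≠ 0 → ContDiffAt ℝ 1 G z := by
    intro z hz
    have h1 : ContDiffAt ℝ 1 (fun z : (V →L[ℝ] V) × V => z.1 e) z :=
      contDiffAt_fst.clm_apply contDiffAt_const
    have h2 : ContDiffAt ℝ 1 G₁ z := ((contDiffAt_const.inner ℝ h1).inv hz).smul h1
    exact h2.prodMk (contDiffAt_snd.sub ((contDiffAt_const.inner ℝ contDiffAt_snd).smul h2))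
  calc dimH Q ≤ dimH (G '' (lineCoords '' {p ∈ Q | p.1 ≠ 0})) :=
        dimH_mono fun p hp => ⟨_, ⟨p, ⟨hp, (key p hp).1⟩, rfl⟩, hG p hp⟩
    _ ≤ dimH (lineCoords '' {p ∈ Q | p.1 ≠ 0}) := dimH_image_le_of_contDiffAt (by
        rintro _ ⟨p, hp, rfl⟩
        refine hsmooth _ ?_
        rw [hne p hp.1]
        exact inv_ne_zero (hpos p hp.1))
    _ = dimH (coords '' lineSet Q) := by rw [coords_image_lineSet]
    _ ≤ dimH (lineSet Q) := lipschitzWith_coords.dimH_image_le _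

theorem isClosed_lineSet {Q : Set (V × V)} (hQ : IsCompact Q) (h0 : ∀ p ∈ Q, p.1 ≠ 0) :
    IsClosed (lineSet Q) := by
  have himg : coords '' lineSet Q = lineCoords '' Q := by
    rw [coords_image_lineSet, sep_eq_self_iff_mem_true.mpr h0]
  have hc : IsCompact (lineCoords '' Q) := hQ.image_of_continuousOn fun p hp =>
    (contDiffAt_lineCoords (h0 p hp)).continuousAt.continuousWithinAt
  rw [← preimage_image_eq (lineSet Q) antilipschitzWith_coords.injective, himg]
  exact hc.isClosed.preimage lipschitzWith_coords.continuous

/-- Dividing a direction by its largest coordinate makes that coordinate `1` and puts the others in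
`[-1, 1]`. This gives `k` charts, each with `k - 1` free direction parameters; each chart is the
smooth image of a product with box counts. -/
theorem dimH_lineSet_le_of_snd_mem {k : ℕ} (B : OrthonormalBasis (Fin k) ℝ V) {κ : Type*}
    [Fintype κ] {τ : κ → ℝ≥0} {K : κ → Set ℝ} (hK : ∀ j, CoveringBound (τ j) (K j))
    (R : (κ → ℝ) →L[ℝ] V) {Q : Set (V × V)} (hQ : ∀ p ∈ Q, p.2 ∈ R '' pi univ K) :
    dimH (lineSet Q) ≤ (((k - 1 : ℕ) + ∑ j, τ j : ℝ≥0) : ℝ≥0∞) := by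
  let c : (Fin k ⊕ κ → ℝ) → V × V := fun y => (∑ j, y (Sum.inl j) • B j, R fun j => y (Sum.inr j))
  have hc : ContDiff ℝ 1 c := by
    refine ContDiff.prodMk ?_ (R.contDiff.comp ?_)
    · exact ContDiff.sum fun j _ => (contDiff_apply ℝ ℝ _).smul contDiff_const
    · exact contDiff_pi.mpr fun j => contDiff_apply ℝ ℝ _
  let L : Fin k → Fin k ⊕ κ → Set ℝ := fun i =>
    Sum.elim (fun j => if j = i then {1} else Icc (-1) 1) K
  let σ : Fin k → Fin k ⊕ κ → ℝ≥0 := fun i => Sum.elim (fun j => if j = i then 0 else 1) τ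
  have hL : ∀ i, dimH (lineSet (c '' pi univ (L i))) ≤
      (((k - 1 : ℕ) + ∑ j, τ j : ℝ≥0) : ℝ≥0∞) := by
    intro i
    have hcov : ∀ j, CoveringBound (σ i j) (L i j) := by
      rintro (j | j)
      · by_cases h : j = i
        · simpa [σ, L, h] using coveringBound_singleton 1
        · simpa [σ, L, h] using coveringBound_Icc_neg_one_one
      · exact hK j
    have hsum : ∑ j, σ i j = (k - 1 : ℕ) + ∑ j, τ j := by
      rw [Fintype.sum_sum_type]
      simp only [σ, Sum.elim_inl, Sum.elim_inr, sum_ite_eq_zero_one, mul_one]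
    rw [← hsum]
    exact (dimH_lineSet_le _).trans ((dimH_image_le_of_contDiffAt fun y _ =>
      hc.contDiffAt).trans (dimH_pi_le hcov))
  have hsub : lineSet Q ⊆ ⋃ i, lineSet (c '' pi univ (L i)) := by
    rintro M ⟨p, hp, hM⟩
    have h0 := fst_ne_zero_of_plane_eq hM
    have hne : (Finset.univ : Finset (Fin k)).Nonempty := by
      by_contra hne
      rw [Finset.not_nonempty_iff_eq_empty] at hne
      exact h0 (by rw [← B.sum_repr p.1, hne, Finset.sum_empty])
    obtain ⟨i, -, hi⟩ := Finset.exists_max_image Finset.univ (fun j => |B.repr p.1 j|) hne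
    have hi0 : B.repr p.1 i ≠ 0 := fun h => h0 (by
      rw [← B.sum_repr p.1]
      refine Finset.sum_eq_zero fun j hj => ?_
      have := hi j hj
      rw [h, abs_zero] at this
      rw [abs_nonpos_iff.mp this, zero_smul])
    obtain ⟨z, hz, hzp⟩ := hQ p hp
    refine mem_iUnion.mpr ⟨i, c (Sum.elim (fun j => (B.repr p.1 i)⁻¹ * B.repr p.1 j) z),
      mem_image_of_mem _ ?_, ?_⟩
    · rintro (j | j) -
      · by_cases h : j = i
        · simp [L, h, hi0]
        · simp only [L, Sum.elim_inl, if_neg h]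
          rw [mem_Icc, ← abs_le, abs_mul, abs_inv, inv_mul_le_one₀ (abs_pos.mpr hi0)]
          exact hi j (Finset.mem_univ j)
      · exact hz j (mem_univ j)
    · have h1 : ∑ j, ((B.repr p.1 i)⁻¹ * B.repr p.1 j) • B j = (B.repr p.1 i)⁻¹ • p.1 := by
        simp only [mul_smul, ← Finset.smul_sum, B.sum_repr]
      simp only [c, Sum.elim_inl, Sum.elim_inr]
      rw [h1, hM, hzp, ← mk'_span_singleton_eq p.1 p.2 (inv_ne_zero hi0) 0, zero_smul, add_zero]
  refine (dimH_mono hsub).trans ?_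
  rw [dimH_iUnion]
  exact iSup_le hL

/-- A line not parallel to the hyperplane orthogonal to `B i` is given by a direction `B i + w` and
its intersection with that hyperplane, hence by two vectors of the hyperplane. Every line is of this
kind for some `i`. -/
theorem dimH_affGrass_one_le {k : ℕ} (hk : finrank ℝ V = k) (s : Set (AffGrass 1 V)) :
    dimH s ≤ ((2 * (k - 1) : ℕ) : ℝ≥0∞) := by
  subst hk
  let B := stdOrthonormalBasis ℝ V
  let W : Fin (finrank ℝ V) → Submodule ℝ V := fun i => (ℝ ∙ B i)ᗮ
  let f : ∀ i, W i × W i → V × V := fun i q => (B i + q.1, q.2)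
  have hf : ∀ i, dimH (lineSet (range (f i))) ≤ ((2 * (finrank ℝ V - 1) : ℕ) : ℝ≥0∞) := by
    intro i
    have hW : finrank ℝ (W i) = finrank ℝ V - 1 := by
      have := (ℝ ∙ B i).finrank_add_finrank_orthogonal
      rw [finrank_span_singleton (B.orthonormal.ne_zero i)] at this
      simp only [W]
      omega
    have hc : ContDiff ℝ 1 (f i) :=
      (contDiff_const.add ((W i).subtypeL.contDiff.comp contDiff_fst)).prodMk
        ((W i).subtypeL.contDiff.comp contDiff_snd)
    refine (dimH_lineSet_le _).trans (hc.dimH_range_le.trans ?_)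
    rw [finrank_prod, hW, ← two_mul]
  have hsub : s ⊆ ⋃ i, lineSet (range (f i)) := by
    intro M _
    obtain ⟨v, hv, hspan⟩ := finrank_eq_one_iff'.mp M.finrank_direction
    have hv0 : (v : V) ≠ 0 := fun h => hv (Subtype.ext h)
    have hdir : M.plane.direction = ℝ ∙ (v : V) := by
      refine le_antisymm (fun w hw => ?_) ?_
      · obtain ⟨a, ha⟩ := hspan ⟨w, hw⟩
        exact Submodule.mem_span_singleton.mpr ⟨a, congrArg Subtype.val ha⟩
      · exact (Submodule.span_singleton_le_iff_mem _ _).mpr v.2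
    obtain ⟨i, hi⟩ : ∃ i, ⟪B i, (v : V)⟫ ≠ 0 := by
      by_contra! h
      refine hv0 ?_
      rw [← B.sum_repr' (v : V)]
      exact Finset.sum_eq_zero fun i _ => by rw [h i, zero_smul]
    have hBi : ⟪B i, B i⟫ = 1 := by simp
    refine mem_iUnion.mpr ⟨i, _, ⟨⟨⟨⟪B i, (v : V)⟫⁻¹ • (v : V) - B i, ?_⟩,
      ⟨M.foot + (-(⟪B i, M.foot⟫ * ⟪B i, (v : V)⟫⁻¹)) • (v : V), ?_⟩⟩, rfl⟩, ?_⟩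
    · rw [Submodule.mem_orthogonal_singleton_iff_inner_right, inner_sub_right, inner_smul_right,
        inv_mul_cancel₀ hi, hBi, sub_self]
    · rw [Submodule.mem_orthogonal_singleton_iff_inner_right, inner_add_right, inner_smul_right]
      field_simp
      ring
    · simp only [f, add_sub_cancel]
      rw [mk'_span_singleton_eq _ _ (inv_ne_zero hi)]
      exact AffineSubspace.ext_of_direction_eq (by simp [hdir])
        ⟨M.foot, M.foot_mem, AffineSubspace.self_mem_mk' _ _⟩
  refine (dimH_mono hsub).trans ?_
  rw [dimH_iUnion]
  exact iSup_le hf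

end Lines

/-! ### Projecting families of lines to a subspace. -/

section Projection

variable {E : Type*} [NormedAddCommGroup E] [InnerProductSpace ℝ E] [FiniteDimensional ℝ E]

theorem dimTarget_proj_image_le (V : Submodule ℝ E) (Q : Set (E × E)) {d : ℝ≥0∞}
    (hl : dimH (lineSet (Prod.map V.orthogonalProjectionOnto V.orthogonalProjectionOnto '' Q)) ≤ d)
    (hp : dimH ((fun p : E × E => V.orthogonalProjectionOnto p.2) '' Q) ≤ d) :
    dimTarget V (proj V '' lineSet Q) ≤ d := by
  let _ : MetricSpace (AffGrass 1 V ⊕ V) := Metric.metricSpaceSum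
  change dimH _ ≤ d
  have hsub : proj V '' lineSet Q ⊆
      Sum.inl '' lineSet (Prod.map V.orthogonalProjectionOnto V.orthogonalProjectionOnto '' Q) ∪
      Sum.inr '' ((fun p : E × E => V.orthogonalProjectionOnto p.2) '' Q) := by
    rintro _ ⟨L, ⟨p, hpQ, hL⟩, rfl⟩
    have himg : imageIn V L = AffineSubspace.mk' (V.orthogonalProjectionOnto p.2)
        (ℝ ∙ V.orthogonalProjectionOnto p.1) := by
      unfold imageIn
      rw [hL, AffineSubspace.map_mk', LinearMap.toAffineMap_linear, Submodule.map_span,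
        image_singleton]
      rfl
    unfold proj
    split_ifs with h
    · exact Or.inl ⟨_, ⟨_, ⟨p, hpQ, rfl⟩, himg⟩, rfl⟩
    · refine Or.inr ⟨_, ⟨p, hpQ, rfl⟩, ?_⟩
      -- If the direction is killed, the foot and `p.2` differ by a multiple of it, so they have the
      -- same projection.
      have h0 : V.orthogonalProjectionOnto p.1 = 0 := by
        by_contra h0
        refine h ?_
        rw [himg, AffineSubspace.direction_mk', finrank_span_singleton h0]
      have hfoot : L.foot = _ := congrArg Prod.snd (coords_eq_lineCoords hL)
      rw [hfoot]
      simp [lineCoords, h0]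
  refine (dimH_mono hsub).trans ?_
  rw [dimH_union, Metric.isometry_inl.dimH_image, Metric.isometry_inr.dimH_image]
  exact max_le hl hp

end Projection

theorem dimTarget_proj_image_le_finrank {E : Type*} [NormedAddCommGroup E] [InnerProductSpace ℝ E]
    [FiniteDimensional ℝ E] {k : ℕ} (hk : 1 < k) (V : Grass k E) (Q : Set (E × E)) :
    dimTarget V.space (proj V.space '' lineSet Q) ≤ ((2 * (k - 1) : ℕ) : ℝ≥0∞) := by
  refine dimTarget_proj_image_le _ _ (dimH_affGrass_one_le V.finrank_space _) ?_
  refine (dimH_mono (subset_univ _)).trans ?_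
  rw [Real.dimH_univ_eq_finrank, V.finrank_space]
  -- The point part may have dimension `k`; `1 < k` makes this harmless.
  exact_mod_cast (by omega : k ≤ 2 * (k - 1))

/-! ### The test families and the choice of their exponents. -/

theorem exists_measurableSet_dimH_eq_dimTarget_le {k n : ℕ} (hk : 1 < k) (hn : 0 < n) {σ τ : ℝ≥0}
    (hσ : σ ≤ 1) (hτ : τ ≤ 1) :
    ∃ A : Set (AffGrass 1 (Euc n)), MeasurableSet A ∧
      dimH A = (((n - 1 : ℕ) * σ + (n - 1 : ℕ) * τ : ℝ≥0) : ℝ≥0∞) ∧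
      ∀ V : Grass k (Euc n),
        dimTarget V.space (proj V.space '' A) ≤ dimH A ∧
        dimTarget V.space (proj V.space '' A) ≤ (((k - 1 : ℕ) + (n - 1 : ℕ) * τ : ℝ≥0) : ℝ≥0∞) ∧
        dimTarget V.space (proj V.space '' A) ≤ ((2 * (k - 1) : ℕ) : ℝ≥0∞) := by
  obtain ⟨K, hKc, hKcov, hKpar⟩ := exists_isCompact_coveringBound_holderParam hσ
  obtain ⟨L, hLc, hLcov, hLpar⟩ := exists_isCompact_coveringBound_holderParam hτ
  -- At `i₀` the direction coordinate is `1` and the position coordinate `0`, as `le_dimH_lineSet`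
  -- needs for the `i₀`-th unit vector.
  let i₀ : Fin n := ⟨0, hn⟩
  let X : Fin n → Set ℝ := fun j => if j = i₀ then {0} else L
  let T : Fin n ⊕ Fin n → Set ℝ := Sum.elim (fun j => if j = i₀ then {1} else K) X
  let ρ : Fin n → ℝ≥0 := fun j => if j = i₀ then 0 else τ
  let s : Fin n ⊕ Fin n → ℝ≥0 := Sum.elim (fun j => if j = i₀ then 0 else σ) ρ
  let e : (Fin n → ℝ) ≃L[ℝ] Euc n := (EuclideanSpace.equiv (Fin n) ℝ).symm
  let c : (Fin n ⊕ Fin n → ℝ) ≃L[ℝ] Euc n × Euc n :=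
    (ContinuousLinearEquiv.sumPiEquivProdPi ℝ _ _ fun _ => ℝ).trans (e.prodCongr e)
  let Q : Set (Euc n × Euc n) := c '' pi univ T
  have hρ : ∑ j, ρ j = (n - 1 : ℕ) * τ := sum_ite_eq_zero_one i₀ τ
  have hs : ∑ j, s j = (n - 1 : ℕ) * σ + (n - 1 : ℕ) * τ := by
    rw [Fintype.sum_sum_type]
    exact congrArg₂ _ (sum_ite_eq_zero_one i₀ σ) hρ
  have hXcov : ∀ j, CoveringBound (ρ j) (X j) := by
    intro j
    by_cases h : j = i₀
    · simpa [ρ, X, h] using coveringBound_singleton 0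
    · simpa [ρ, X, h] using hLcov
  have hTcov : ∀ j, CoveringBound (s j) (T j) := by
    rintro (j | j)
    · by_cases h : j = i₀
      · simpa [s, T, h] using coveringBound_singleton 1
      · simpa [s, T, h] using hKcov
    · exact hXcov j
  have hTpar : ∀ j, HolderParam (s j) (T j) := by
    rintro (j | j) <;> by_cases h : j = i₀
    · simpa [s, T, h] using holderParam_singleton 1
    · simpa [s, T, h] using hKpar
    · simpa [s, T, ρ, X, h] using holderParam_singleton 0
    · simpa [s, T, ρ, X, h] using hLpar
  have hTc : ∀ j, IsCompact (T j) := by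
    rintro (j | j) <;> by_cases h : j = i₀ <;> simp [T, X, h, hKc, hLc]
  have hQc : IsCompact Q := (isCompact_univ_pi hTc).image c.continuous
  have hQe : ∀ p ∈ Q, ⟪EuclideanSpace.single i₀ (1 : ℝ), p.1⟫ = 1 ∧
      ⟪EuclideanSpace.single i₀ (1 : ℝ), p.2⟫ = 0 := by
    rintro _ ⟨y, hy, rfl⟩
    have h1 : y (Sum.inl i₀) = 1 := by simpa [T] using hy (Sum.inl i₀) (mem_univ _)
    have h2 : y (Sum.inr i₀) = 0 := by simpa [T, X] using hy (Sum.inr i₀) (mem_univ _)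
    rw [EuclideanSpace.inner_single_left, EuclideanSpace.inner_single_left, map_one, one_mul,
      one_mul]
    exact ⟨h1, h2⟩
  have hQ0 : ∀ p ∈ Q, p.1 ≠ 0 := fun p hp h => by
    have := (hQe p hp).1
    rw [h, inner_zero_right] at this
    exact zero_ne_one this
  have hdimQ : dimH Q = (((n - 1 : ℕ) * σ + (n - 1 : ℕ) * τ : ℝ≥0) : ℝ≥0∞) := by
    rw [← hs, c.dimH_image]
    exact le_antisymm (dimH_pi_le hTcov) (le_dimH_pi hTpar)
  have hdim : dimH (lineSet Q) = dimH Q :=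
    le_antisymm (dimH_lineSet_le Q) (le_dimH_lineSet _ hQe)
  refine ⟨lineSet Q, (isClosed_lineSet hQc hQ0).measurableSet, hdim.trans hdimQ, fun V => ⟨?_, ?_,
    dimTarget_proj_image_le_finrank hk V Q⟩⟩
  · rw [hdim]
    -- The comparison is made on the parameters `(v, x)`, where projection is linear, so lines
    -- nearly orthogonal to `V` cause no trouble.
    refine dimTarget_proj_image_le _ _ ((dimH_lineSet_le _).trans ?_) ?_
    · exact dimH_image_le_of_contDiffAt fun p _ =>
        (V.space.orthogonalProjectionOnto.prodMap
          V.space.orthogonalProjectionOnto).contDiff.contDiffAt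
    · exact dimH_image_le_of_contDiffAt fun p _ =>
        V.space.orthogonalProjectionOnto.contDiff.contDiffAt.comp p contDiffAt_snd
  · let R : (Fin n → ℝ) →L[ℝ] V.space := V.space.orthogonalProjectionOnto ∘L e.toContinuousLinearMap
    have hR : ∀ p ∈ Q, V.space.orthogonalProjectionOnto p.2 ∈ R '' pi univ X := by
      rintro _ ⟨y, hy, rfl⟩
      exact ⟨fun j => y (Sum.inr j), fun j _ => hy (Sum.inr j) (mem_univ _), rfl⟩
    have hB := (stdOrthonormalBasis ℝ V.space).reindex (finCongr V.finrank_space)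
    rw [← hρ]
    refine dimTarget_proj_image_le _ _ (dimH_lineSet_le_of_snd_mem hB hXcov R ?_) ?_
    · rintro _ ⟨p, hp, rfl⟩
      exact hR p hp
    · calc _ ≤ dimH (R '' pi univ X) := dimH_mono (image_subset_iff.mpr hR)
        _ ≤ dimH (pi univ X) := dimH_image_le_of_contDiffAt fun _ _ => R.contDiff.contDiffAt
        _ ≤ ((∑ j, ρ j : ℝ≥0) : ℝ≥0∞) := dimH_pi_le hXcov
        _ ≤ _ := ENNReal.coe_le_coe.mpr le_add_self

/-- One test family, bounded for every `V` and not just almost every `V`, suffices. -/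
theorem S_le {k n : ℕ} (h : k ≤ n) {a : ℝ} {A : Set (AffGrass 1 (Euc n))} (hA : MeasurableSet A)
    (ha : dimH A = ENNReal.ofReal a) {d : ℝ≥0∞}
    (hd : ∀ V : Grass k (Euc n), dimTarget V.space (proj V.space '' A) ≤ d) : S h a ≤ d :=
  (iInf₂_le A hA).trans ((iInf_le _ ha).trans (essSup_le_of_ae_le _ (Eventually.of_forall hd)))

end LineProjection

end

open LineProjection in
theorem proposition1p4 (k n : ℕ) (hk : 1 < k) (hkn : k < n) :
    (∀ a : ℝ, 0 ≤ a → a ≤ (n : ℝ) - 1 →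
      LineProjection.S hkn.le a ≤ ENNReal.ofReal (min a ((k : ℝ) - 1))) ∧
    (∀ a : ℝ, (n : ℝ) - 1 ≤ a → a ≤ 2 * ((n : ℝ) - 1) →
      LineProjection.S hkn.le a ≤
        ENNReal.ofReal (min (a - ((n : ℝ) - (k : ℝ))) (2 * ((k : ℝ) - 1)))) := by
  have hn1 : ((n - 1 : ℕ) : ℝ) = n - 1 := Nat.cast_pred (by omega)
  have hk1 : ((k - 1 : ℕ) : ℝ) = k - 1 := Nat.cast_pred (by omega)
  have hpos : (0 : ℝ) < (n : ℝ) - 1 := by rw [← hn1]; exact_mod_cast (by omega : 0 < n - 1)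
  have hcast : ∀ (x : NNReal) (y : ℝ), (x : ℝ) = y → (x : ℝ≥0∞) = ENNReal.ofReal y := by
    rintro x _ rfl
    exact (ENNReal.ofReal_coe_nnreal).symm
  have hmin : ∀ x y : ℝ, ENNReal.ofReal (min x y) = min (ENNReal.ofReal x) (ENNReal.ofReal y) :=
    fun x y => ENNReal.ofReal_mono.map_min
  constructor
  · intro a ha0 ha
    -- Positions get dimension `0`, so the directions carry all of `a = (n - 1)σ`.
    obtain ⟨σ, hσ⟩ : ∃ σ : NNReal, (σ : ℝ) = a / (n - 1) := ⟨⟨_, by positivity⟩, rfl⟩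
    have hσ1 : σ ≤ 1 := by
      rw [← NNReal.coe_le_coe, hσ]
      exact (div_le_one hpos).mpr ha
    obtain ⟨A, hA, hdim, hV⟩ := exists_measurableSet_dimH_eq_dimTarget_le hk (by omega : 0 < n)
      hσ1 zero_le_one
    have hdim' : dimH A = ENNReal.ofReal a := hdim.trans (hcast _ _ (by
      simp only [NNReal.coe_add, NNReal.coe_mul, NNReal.coe_natCast, NNReal.coe_zero,
        hn1, hσ]
      field_simp
      ring))
    refine S_le _ hA hdim' fun V => ?_
    rw [hmin]
    refine le_min ((hV V).1.trans hdim'.le) ((hV V).2.1.trans (hcast _ _ ?_).le)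
    simp only [NNReal.coe_add, NNReal.coe_mul, NNReal.coe_natCast, NNReal.coe_zero,
        hk1]
    ring
  · intro a ha0 ha
    -- With `σ = 1` the positions carry `(n - 1)τ = a - (n - 1)`, and `(k - 1) + (n - 1)τ = a - (n -
    -- k)`.
    obtain ⟨τ, hτ⟩ : ∃ τ : NNReal, (τ : ℝ) = (a - (n - 1)) / (n - 1) :=
      ⟨⟨_, div_nonneg (by linarith) hpos.le⟩, rfl⟩
    have hτ1 : τ ≤ 1 := by
      rw [← NNReal.coe_le_coe, hτ]
      exact (div_le_one hpos).mpr (by linarith)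
    obtain ⟨A, hA, hdim, hV⟩ := exists_measurableSet_dimH_eq_dimTarget_le hk (by omega : 0 < n)
      le_rfl hτ1
    have hdim' : dimH A = ENNReal.ofReal a := hdim.trans (hcast _ _ (by
      simp only [NNReal.coe_add, NNReal.coe_mul, NNReal.coe_natCast, NNReal.coe_one,
        hn1, hτ]
      field_simp
      ring))
    refine S_le _ hA hdim' fun V => ?_
    rw [hmin]
    refine le_min ((hV V).2.1.trans (hcast _ _ ?_).le) ((hV V).2.2.trans ?_)
    · simp only [NNReal.coe_add, NNReal.coe_mul, NNReal.coe_natCast, hn1, hk1,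
        hτ]
      field_simp
      ring
    · rw [← hk1, ← ENNReal.ofReal_natCast]
      push_cast
      exact le_rfl
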